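/- For a finite simple graph $G$, let $\mathcal A(G)$ be the set of its arcs, i.e. the ordered pairs $(u,v)$ and $(v,u)$ for each edge $uv$; an arc $e=(u,v)$ has origin $o(e)=u$, terminus $t(e)=v$ and inverse $e^{-1}=(v,u)$. The Grover transfer matrix $U=U(G)$ is the matrix indexed by $\mathcal A(G)$ with \[ U_{e,f}=\begin{cases} 2/\deg(t(f)) & \text{if } t(f)=o(e),\ e\neq f^{-1},\\ 2/\deg(t(f))-1 & \text{if } e=f^{-1},\\ 0 & \text{otherwise.}\end{cases} \] The graph $G$ is called periodic (it induces a periodic Grover walk) if there is an integer $\tau\ge 1$ such that $U^{\tau}=I$ and $U^{j}\ne I$ for all $0<j<\tau$. For integers $1\le k<n$, the Johnson graph $J(n,k)$ has as vertices the $k$-element subsets of an $n$-element set, with $x,y$ adjacent if and only if $|x\cap y|=k-1$. Theorem. Let $1\le k<n$. The Johnson graph $J(n,k)$ is periodic if and only if \[(n,k)\in\{(2,1),(3,1),(3,2),(4,2)\}.\] (Here $J(3,2)\cong J(3,1)$, so up to isomorphism the periodic Johnson graphs are exactly $J(2,1)$, $J(3,1)$ and $J(4,2)$.) -/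

import Mathlib

/-- The Johnson graph `J(n, k)`: its vertices are the `k`-element subsets of an `n`-element set, and
two vertices `x`, `y` are adjacent iff `|x ∩ y| = k - 1`. (Written `|x ∩ y| + 1 = k`, so that no
truncated subtraction occurs.) -/
def johnsonGraph (n k : ℕ) : SimpleGraph {s : Finset (Fin n) // s.card = k} where
  Adj x y := (x.1 ∩ y.1).card + 1 = k
  symm := ⟨fun x y h => by rwa [Finset.inter_comm]⟩
  loopless := ⟨fun x h => by
    rw [Finset.inter_self, x.2] at h
    omega⟩

instance (n k : ℕ) : DecidableRel (johnsonGraph n k).Adj := fun x y =>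
  inferInstanceAs (Decidable ((x.1 ∩ y.1).card + 1 = k))

namespace SimpleGraph

variable {V : Type*} [Fintype V] [DecidableEq V]

/-- The Grover transfer matrix `U(G)` of a finite simple graph, indexed by the symmetric arcs of `G`
(the darts: `e.fst` is the origin of `e`, `e.snd` its terminus, `e.symm` the inverse arc). -/
noncomputable def groverMatrix (G : SimpleGraph V) [DecidableRel G.Adj] :
    Matrix G.Dart G.Dart ℂ :=
  Matrix.of fun e f =>
    if e = f.symm then 2 / (G.degree f.snd : ℂ) - 1
    else if f.snd = e.fst then 2 / (G.degree f.snd : ℂ)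
    else 0

/-- `G` induces a `τ`-periodic Grover walk: `τ` is a positive integer with `U(G) ^ τ = I`, and
`U(G) ^ j ≠ I` whenever `0 < j < τ`. -/
def IsGroverPeriodicWith (G : SimpleGraph V) [DecidableRel G.Adj] (τ : ℕ) : Prop :=
  0 < τ ∧ G.groverMatrix ^ τ = 1 ∧ ∀ j : ℕ, 0 < j → j < τ → G.groverMatrix ^ j ≠ 1

/-- `G` is periodic: it induces a `τ`-periodic Grover walk for some `τ`. -/
def IsGroverPeriodic (G : SimpleGraph V) [DecidableRel G.Adj] : Prop :=
  ∃ τ : ℕ, G.IsGroverPeriodicWith τ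

end SimpleGraph

open Matrix

namespace SimpleGraph

variable {V : Type*} [Fintype V] [DecidableEq V] (G : SimpleGraph V) [DecidableRel G.Adj]

/-! On a `d`-regular graph, lifting a vertex function with adjacency eigenvalue `λ` to arcs via
origin and terminus exposes eigenvalues `z` of `U` with `z + z⁻¹ = 2λ/d`. Periodicity makes `z` a
root of unity, so `2λ/d` is an algebraic integer. For `J(n,k)`, of degree `k(n-k)`, products of
differences over disjoint pairs of points give `λ = -min(k, n-k)`. The rational number `2λ/d =
-2/max(k, n-k)` is then an integer, so `max(k, n-k) ≤ 2`, which leaves exactly the four listed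
pairs.

Conversely, `J(2,1)` is a single edge, with `U² = 1`. For the other three, `C = 2A/d` (`A` the
adjacency matrix) satisfies `C² + C = αJ`: off the constants, `z + z⁻¹` is `0` or `-1`, which points
to `U¹² = 1`. -/

theorem groverMatrix_apply (e f : G.Dart) :
    G.groverMatrix e f =
      (if f.snd = e.fst then 2 / (G.degree e.fst : ℂ) else 0) - if f = e.symm then 1 else 0 := by
  have h : e = f.symm ↔ f = e.symm :=
    ⟨fun h => by rw [h, Dart.symm_symm], fun h => by rw [h, Dart.symm_symm]⟩
  by_cases h1 : f = e.symm
  · subst h1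
    have hs : e.symm.snd = e.fst := rfl
    rw [groverMatrix, of_apply, hs]
    simp
  · by_cases h2 : f.snd = e.fst
    · rw [groverMatrix, of_apply, h2]
      simp [h, h1]
    · simp [groverMatrix, h, h1, h2]

theorem groverMatrix_mulVec (x : G.Dart → ℂ) (e : G.Dart) :
    (G.groverMatrix *ᵥ x) e =
      2 / (G.degree e.fst : ℂ) * (∑ f : G.Dart, if f.snd = e.fst then x f else 0) - x e.symm := by
  simp only [mulVec, dotProduct, groverMatrix_apply, sub_mul, Finset.sum_sub_distrib,
    Finset.mul_sum]
  congr 1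
  · exact Finset.sum_congr rfl fun f _ => by split_ifs <;> simp
  · simp

theorem sum_darts_snd_eq (g : V → ℂ) (v : V) :
    (∑ f : G.Dart, if f.snd = v then g f.fst else 0) = ∑ w ∈ G.neighborFinset v, g w := by
  rw [← Finset.sum_filter]
  refine Finset.sum_bij' (fun f _ => f.fst)
    (fun w hw => (⟨(w, v), ((G.mem_neighborFinset v w).1 hw).symm⟩ : G.Dart)) ?_ ?_ ?_ ?_ ?_
  · rintro f hf
    obtain ⟨-, rfl⟩ := Finset.mem_filter.1 hf
    exact (G.mem_neighborFinset _ _).2 f.adj.symm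
  · intro w hw
    simp
  · rintro f hf
    obtain ⟨-, rfl⟩ := Finset.mem_filter.1 hf
    rfl
  · intro w hw
    rfl
  · intro f hf
    rfl

variable {G} {d : ℕ}

/-! ### Vertex functions lifted to arcs, and integrality -/

theorem IsRegularOfDegree.groverMatrix_mulVec_fst (hG : G.IsRegularOfDegree d) (f : V → ℂ) :
    G.groverMatrix *ᵥ (fun e => f e.fst) =
      (fun e => 2 / (d : ℂ) * ∑ w ∈ G.neighborFinset e.fst, f w) - fun e => f e.snd := by
  ext e
  rw [groverMatrix_mulVec, sum_darts_snd_eq, hG.degree_eq]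
  rfl

theorem IsRegularOfDegree.groverMatrix_mulVec_snd (hG : G.IsRegularOfDegree d) (hd : d ≠ 0)
    (f : V → ℂ) :
    G.groverMatrix *ᵥ (fun e => f e.snd) = fun e => f e.fst := by
  ext e
  have h : (∑ a : G.Dart, if a.snd = e.fst then f a.snd else 0) = d * f e.fst := by
    rw [← hG.degree_eq e.fst, ← card_neighborFinset_eq_degree, ← nsmul_eq_mul,
      ← Finset.sum_const, ← sum_darts_snd_eq G (fun _ => f e.fst)]
    refine Finset.sum_congr rfl fun a _ => ?_
    split_ifs with h
    · rw [h]
    · rfl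
  have hd' : (d : ℂ) ≠ 0 := Nat.cast_ne_zero.2 hd
  rw [groverMatrix_mulVec, h, hG.degree_eq]
  change 2 / (d : ℂ) * (d * f e.fst) - f e.fst = f e.fst
  field_simp
  ring

theorem pow_mulVec_of_eigenvector {ι : Type*} [Fintype ι] [DecidableEq ι] {M : Matrix ι ι ℂ}
    {w : ι → ℂ} {z : ℂ} (h : M *ᵥ w = z • w) (t : ℕ) : (M ^ t) *ᵥ w = z ^ t • w := by
  induction t with
  | zero => simp
  | succ t ih => rw [pow_succ, ← mulVec_mulVec, h, mulVec_smul, ih, smul_smul, pow_succ']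

/-- On a periodic regular graph, twice every eigenvalue of the simple random walk is an algebraic
integer. -/
theorem IsRegularOfDegree.isIntegral_of_groverMatrix_pow_eq_one (hG : G.IsRegularOfDegree d)
    (hd : d ≠ 0) {t : ℕ} (ht : 0 < t) (hU : G.groverMatrix ^ t = 1) {f : V → ℂ} {lam : ℂ}
    (hf : ∀ v, ∑ w ∈ G.neighborFinset v, f w = lam * f v) {v₀ : V} (hv₀ : f v₀ ≠ 0) :
    IsIntegral ℤ (2 * lam / d) := by
  set c : ℂ := 2 * lam / d with hc
  obtain ⟨z, hz⟩ : ∃ z : ℂ, z ^ 2 - c * z + 1 = 0 := by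
    obtain ⟨s, hs⟩ := IsAlgClosed.exists_pow_nat_eq (c ^ 2 - 4) two_pos
    exact ⟨(c + s) / 2, by linear_combination hs / 4⟩
  have hz0 : z ≠ 0 := by
    rintro rfl
    norm_num at hz
  have hcz : c = z + z⁻¹ := by
    field_simp
    linear_combination -hz
  have hroot : ∀ y : ℂ, ∀ m : ℕ, 0 < m → y ^ m = 1 → IsIntegral ℤ y := fun y m hm h =>
    IsIntegral.of_pow hm (h ▸ isIntegral_one)
  suffices ∃ m : ℕ, 0 < m ∧ z ^ m = 1 by
    obtain ⟨m, hm, h⟩ := this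
    rw [hcz]
    exact (hroot z m hm h).add (hroot _ m hm (by rw [inv_pow, h, inv_one]))
  -- The candidate eigenvector `f(origin) - z f(terminus)` may vanish; in that case crossing one
  -- edge both ways forces `z² = 1`.
  by_cases hw : ∀ e : G.Dart, f e.fst = z * f e.snd
  · obtain ⟨w, hvw⟩ : (G.neighborFinset v₀).Nonempty := by
      rw [← Finset.card_pos, card_neighborFinset_eq_degree, hG.degree_eq]
      exact Nat.pos_of_ne_zero hd
    have hadj := (G.mem_neighborFinset _ _).1 hvw
    have h1 : f v₀ = z * f w := hw ⟨(v₀, w), hadj⟩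
    have h2 : f w = z * f v₀ := hw ⟨(w, v₀), hadj.symm⟩
    refine ⟨2, two_pos, mul_right_cancel₀ hv₀ ?_⟩
    linear_combination -h1 - z * h2
  · push Not at hw
    obtain ⟨e₀, he₀⟩ := hw
    have hU1 : G.groverMatrix *ᵥ (fun e => f e.fst) = fun e => c * f e.fst - f e.snd := by
      rw [hG.groverMatrix_mulVec_fst]
      ext e
      simp only [Pi.sub_apply, hf, hc]
      ring
    have heig : G.groverMatrix *ᵥ ((fun e => f e.fst) - z • fun e => f e.snd) =
        z⁻¹ • ((fun e => f e.fst) - z • fun e => f e.snd) := by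
      rw [mulVec_sub, mulVec_smul, hU1, hG.groverMatrix_mulVec_snd hd]
      ext e
      simp only [Pi.sub_apply, Pi.smul_apply, smul_eq_mul, hcz]
      field_simp
      ring
    have h := congrFun (pow_mulVec_of_eigenvector heig t) e₀
    rw [hU, one_mulVec] at h
    simp only [Pi.sub_apply, Pi.smul_apply, smul_eq_mul] at h
    refine ⟨t, ht, ?_⟩
    have h1 : (z⁻¹) ^ t = 1 := mul_right_cancel₀ (sub_ne_zero.2 he₀) (by rw [← h, one_mul])
    rw [inv_pow] at h1
    exact inv_eq_one.1 h1

theorem isGroverPeriodic_iff_exists_pow :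
    G.IsGroverPeriodic ↔ ∃ t : ℕ, 0 < t ∧ G.groverMatrix ^ t = 1 := by
  classical
  constructor
  · rintro ⟨t, h0, h1, -⟩
    exact ⟨t, h0, h1⟩
  · intro h
    refine ⟨Nat.find h, (Nat.find_spec h).1, (Nat.find_spec h).2, fun j hj hlt hU => ?_⟩
    exact Nat.find_min h hlt ⟨hj, hU⟩

/-! ### A sufficient condition for period dividing 12 -/

theorem IsRegularOfDegree.groverMatrix_mulVec_eq (hG : G.IsRegularOfDegree d) (x : G.Dart → ℂ) :
    G.groverMatrix *ᵥ x =
      (fun e => 2 / (d : ℂ) * ∑ f : G.Dart, if f.snd = e.fst then x f else 0) -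
        fun e => x e.symm := by
  ext e
  rw [groverMatrix_mulVec, hG.degree_eq]
  rfl

/-- If twice the transition matrix `C` of a regular graph satisfies `C² + C = α J` for the all-ones
matrix `J`, then `U ^ 12 = 1`. -/
theorem IsRegularOfDegree.groverMatrix_pow_twelve (hG : G.IsRegularOfDegree d) (hd : d ≠ 0)
    {α : ℂ} (hC : ∀ (g : V → ℂ) (v : V),
      2 / (d : ℂ) * ∑ w ∈ G.neighborFinset v, 2 / (d : ℂ) * ∑ u ∈ G.neighborFinset w, g u +
        2 / (d : ℂ) * ∑ w ∈ G.neighborFinset v, g w = α * ∑ u, g u) :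
    G.groverMatrix ^ 12 = 1 := by
  set U := G.groverMatrix with hUdef
  let O : (V → ℂ) → G.Dart → ℂ := fun g e => g e.fst
  let T : (V → ℂ) → G.Dart → ℂ := fun g e => g e.snd
  let C : (V → ℂ) → V → ℂ := fun g v => 2 / (d : ℂ) * ∑ w ∈ G.neighborFinset v, g w
  have hO : ∀ g, U *ᵥ O g = O (C g) - T g := fun g => hG.groverMatrix_mulVec_fst g
  have hT : ∀ g, U *ᵥ T g = O g := fun g => hG.groverMatrix_mulVec_snd hd g
  have hOO : ∀ g, U *ᵥ (U *ᵥ O g) = U *ᵥ O (C g) - O g := fun g => by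
    rw [hO g, mulVec_sub, hT]
  have h4 : ∀ g, (U ^ 2 + 1) *ᵥ O g = U *ᵥ O (C g) := fun g => by
    rw [add_mulVec, one_mulVec, pow_two, ← mulVec_mulVec, hOO, sub_add_cancel]
  have h3 : ∀ g, (U ^ 2 + U + 1) *ᵥ O g = U *ᵥ O (C g + g) := fun g => by
    have : O (C g + g) = O (C g) + O g := rfl
    rw [add_mulVec, add_mulVec, one_mulVec, pow_two, ← mulVec_mulVec, hOO, this, mulVec_add]
    abel
  have hconst : ∀ s : ℂ, U *ᵥ (fun _ => s) = fun _ => s := fun s => hT fun _ => s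
  -- `U² + 1` replaces `g` by `Cg` and `U² + U + 1` replaces it by `Cg + g`, each at the cost of one
  -- factor `U`, which fixes the resulting constant.
  have hkill : ∀ g, ((U ^ 2 + U + 1) * (U ^ 2 + 1)) *ᵥ O g = fun _ => α * ∑ u, g u := fun g => by
    have hcomm : (U ^ 2 + U + 1) * U = U * (U ^ 2 + U + 1) := by noncomm_ring
    have hJ : O (C (C g) + C g) = fun _ => α * ∑ u, g u := funext fun e => hC g e.fst
    rw [← mulVec_mulVec, h4, mulVec_mulVec, hcomm, ← mulVec_mulVec, h3, hJ, hconst, hconst]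
  -- `U² - 1` maps every vector to a combination of origin lifts; the two constants left by `hkill`
  -- cancel because reversing arcs preserves the total sum.
  have hmain : ((U ^ 2 + U + 1) * (U ^ 2 + 1)) * (U ^ 2 - 1) = 0 := by
    refine mulVec_injective (funext fun x => ?_)
    let K : (G.Dart → ℂ) → V → ℂ := fun x v =>
      2 / (d : ℂ) * ∑ f : G.Dart, if f.snd = v then x f else 0
    have hK : ∀ x, ∑ v, K x v = 2 / (d : ℂ) * ∑ f, x f := fun x => by
      simp only [K, ← Finset.mul_sum]
      rw [Finset.sum_comm]
      simp
    let S : (G.Dart → ℂ) → G.Dart → ℂ := fun x e => x e.symm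
    have hS : ∑ f, S x f = ∑ f, x f :=
      Fintype.sum_equiv (Function.Involutive.toPerm Dart.symm Dart.symm_involutive) _ _
        fun _ => rfl
    have hUx : ∀ x, U *ᵥ x = O (K x) - S x := fun x => hG.groverMatrix_mulVec_eq x
    have hSS : S (S x) = x := funext fun e => by simp [S]
    have h2 : (U ^ 2 - 1) *ᵥ x = U *ᵥ O (K x) - O (K (S x)) := by
      rw [sub_mulVec, one_mulVec, pow_two, ← mulVec_mulVec, hUx x, mulVec_sub, hUx (S x), hSS]
      abel
    have hcomm : ((U ^ 2 + U + 1) * (U ^ 2 + 1)) * U = U * ((U ^ 2 + U + 1) * (U ^ 2 + 1)) := by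
      noncomm_ring
    rw [← mulVec_mulVec, h2, mulVec_sub, mulVec_mulVec, hcomm, ← mulVec_mulVec, hkill, hkill,
      hconst, hK, hK, hS, sub_self, zero_mulVec]
  -- The cyclotomic factorization of `X¹² - 1`; the last two factors are `Φ₆` and `Φ₁₂`.
  have hfactor : U ^ 12 - 1 = (U ^ 2 + U + 1) * (U ^ 2 + 1) * (U ^ 2 - 1) *
      ((U ^ 2 - U + 1) * (U ^ 4 - U ^ 2 + 1)) := by
    noncomm_ring
  rw [hmain, zero_mul] at hfactor
  exact sub_eq_zero.1 hfactor

/-- A combinatorial form of `groverMatrix_pow_twelve`, by counting common neighbours. -/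
theorem IsRegularOfDegree.groverMatrix_pow_twelve_of_card_inter (hG : G.IsRegularOfDegree d)
    (hd : d ≠ 0) {b : ℕ}
    (hb : ∀ u v, 4 * (G.neighborFinset u ∩ G.neighborFinset v).card +
      2 * d * (if G.Adj u v then 1 else 0) = b) :
    G.groverMatrix ^ 12 = 1 := by
  have hd' : (d : ℂ) ≠ 0 := Nat.cast_ne_zero.2 hd
  refine hG.groverMatrix_pow_twelve hd (α := b / d ^ 2) fun g v => ?_
  have h1 : ∑ w ∈ G.neighborFinset v, 2 / (d : ℂ) * ∑ u ∈ G.neighborFinset w, g u =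
      2 / d * ∑ u, ((G.neighborFinset v ∩ G.neighborFinset u).card : ℂ) * g u := by
    rw [← Finset.mul_sum]
    congr 1
    have : ∀ w, ∑ u ∈ G.neighborFinset w, g u =
        ∑ u, if w ∈ G.neighborFinset u then g u else 0 := fun w => by
      rw [← Finset.sum_filter]
      refine Finset.sum_congr ?_ fun _ _ => rfl
      ext u
      simp [adj_comm]
    simp only [this]
    rw [Finset.sum_comm]
    refine Finset.sum_congr rfl fun u _ => ?_
    rw [← Finset.sum_filter, Finset.filter_mem_eq_inter, Finset.sum_const, nsmul_eq_mul]
  have h2 : ∑ w ∈ G.neighborFinset v, g w = ∑ u, (if G.Adj v u then 1 else 0 : ℂ) * g u := by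
    simp only [ite_mul, one_mul, zero_mul, ← Finset.sum_filter]
    refine Finset.sum_congr ?_ fun _ _ => rfl
    ext u
    simp
  rw [h1, h2]
  simp only [Finset.mul_sum, ← Finset.sum_add_distrib]
  refine Finset.sum_congr rfl fun u _ => ?_
  have hbu := congrArg (Nat.cast : ℕ → ℂ) (hb v u)
  push_cast at hbu
  rw [← hbu]
  field_simp
  ring

end SimpleGraph

/-! ### Johnson graphs: degree and an explicit eigenfunction -/

section Johnson

open SimpleGraph

variable {n : ℕ}

/-- The exchange `S ↦ S - x + y` enumerates the neighbours of a vertex of `J(n, k)`. -/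
theorem johnsonGraph_sum_neighborFinset {k : ℕ} (g : Finset (Fin n) → ℂ)
    (S : {s : Finset (Fin n) // s.card = k}) :
    ∑ R ∈ (johnsonGraph n k).neighborFinset S, g R.1 =
      ∑ x ∈ S.1, ∑ y ∈ S.1ᶜ, g (insert y (S.1.erase x)) := by
  rw [← Finset.sum_product']
  symm
  obtain ⟨S, rfl⟩ := S
  have hcard : ∀ p ∈ S ×ˢ Sᶜ, (insert p.2 (S.erase p.1)).card = S.card := by
    rintro ⟨x, y⟩ h
    simp only [Finset.mem_product, Finset.mem_compl] at h
    rw [Finset.card_insert_of_notMem (fun hy => h.2 (Finset.mem_of_mem_erase hy)),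
      Finset.card_erase_add_one h.1]
  refine Finset.sum_bij (fun p hp => ⟨insert p.2 (S.erase p.1), hcard p hp⟩) ?_ ?_ ?_ ?_
  · rintro ⟨x, y⟩ h
    simp only [Finset.mem_product, Finset.mem_compl] at h
    rw [mem_neighborFinset]
    change (S ∩ insert y (S.erase x)).card + 1 = S.card
    rw [Finset.inter_insert_of_notMem h.2, Finset.inter_eq_right.2 (Finset.erase_subset _ _),
      Finset.card_erase_add_one h.1]
  · rintro ⟨x, y⟩ h ⟨x', y'⟩ h' heq
    simp only [Finset.mem_product, Finset.mem_compl] at h h'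
    simp only [Subtype.mk.injEq, Finset.ext_iff, Finset.mem_insert, Finset.mem_erase] at heq
    have hy := heq y
    have hx := heq x
    ext1 <;> grind
  · rintro ⟨R, hR⟩ h
    rw [mem_neighborFinset] at h
    change (S ∩ R).card + 1 = S.card at h
    have h1 : (S \ R).card = 1 := by
      have := Finset.card_sdiff_add_card_inter S R
      omega
    have h2 : (R \ S).card = 1 := by
      have := Finset.card_sdiff_add_card_inter R S
      rw [Finset.inter_comm] at this
      omega
    obtain ⟨x, hx⟩ := Finset.card_eq_one.1 h1
    obtain ⟨y, hy⟩ := Finset.card_eq_one.1 h2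
    simp only [Finset.ext_iff, Finset.mem_sdiff, Finset.mem_singleton] at hx hy
    refine ⟨(x, y), ?_, ?_⟩
    · have := hx x
      have := hy y
      simp only [Finset.mem_product, Finset.mem_compl]
      tauto
    · rw [Subtype.mk.injEq]
      ext a
      have := hx a
      have := hy a
      simp only [Finset.mem_insert, Finset.mem_erase]
      tauto
  · intros
    rfl

theorem johnsonGraph_isRegularOfDegree (n k : ℕ) :
    (johnsonGraph n k).IsRegularOfDegree (k * (n - k)) := by
  intro S
  have h := johnsonGraph_sum_neighborFinset (fun _ => 1) S
  simp only [Finset.sum_const, Finset.card_compl, S.2, Fintype.card_fin, nsmul_eq_mul, mul_one,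
    card_neighborFinset_eq_degree] at h
  exact_mod_cast h

variable {m : ℕ}

/-- The difference `[aᵢ ∈ S] - [bᵢ ∈ S]` for the pair `aᵢ = i`, `bᵢ = i + m` with `i < m`. -/
noncomputable def pairSign (h : 2 * m ≤ n) (S : Finset (Fin n)) (i : Fin m) : ℂ :=
  (if (⟨i, by omega⟩ : Fin n) ∈ S then 1 else 0) - if (⟨i + m, by omega⟩ : Fin n) ∈ S then 1 else 0

/-- The product of the differences `[aᵢ ∈ S] - [bᵢ ∈ S]` over the pairs `aᵢ = i`, `bᵢ = i + m`. -/
noncomputable def pairProduct (h : 2 * m ≤ n) (S : Finset (Fin n)) : ℂ :=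
  ∏ i : Fin m, pairSign h S i

/-- Having fewer than `m` elements, `T` misses both points of some pair. Only inserting one of these
two points gives a possibly nonzero term, and the two terms are opposite. -/
theorem sum_pairProduct_insert (h : 2 * m ≤ n) {T : Finset (Fin n)} (hT : T.card < m) :
    ∑ y ∈ Tᶜ, pairProduct h (insert y T) = 0 := by
  obtain ⟨i, hi, hiT⟩ : ∃ i ∈ Finset.range m, i ∉ T.image fun x => x.val % m := by
    refine Finset.exists_mem_notMem_of_card_lt_card ?_
    rw [Finset.card_range]
    exact Finset.card_image_le.trans_lt hT
  rw [Finset.mem_range] at hi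
  set a : Fin n := ⟨i, by omega⟩ with ha
  set b : Fin n := ⟨i + m, by omega⟩ with hb
  have haT : a ∉ T := fun hmem =>
    hiT (Finset.mem_image.2 ⟨a, hmem, Nat.mod_eq_of_lt hi⟩)
  have hbT : b ∉ T := fun hmem =>
    hiT (Finset.mem_image.2 ⟨b, hmem, by simp [hb, Nat.mod_eq_of_lt hi]⟩)
  let P : ℂ := ∏ j ∈ Finset.univ.erase (⟨i, hi⟩ : Fin m), pairSign h T j
  have hrest : ∀ y, y = a ∨ y = b →
      ∏ j ∈ Finset.univ.erase (⟨i, hi⟩ : Fin m), pairSign h (insert y T) j = P := by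
    intro y hy
    refine Finset.prod_congr rfl fun j hj => ?_
    have hji : (j : ℕ) ≠ i := fun hji => Finset.ne_of_mem_erase hj (Fin.ext hji)
    have h1 : (⟨j, by omega⟩ : Fin n) ≠ y := by
      rcases hy with rfl | rfl <;> simp only [ha, hb, ne_eq, Fin.mk.injEq] <;> omega
    have h2 : (⟨j + m, by omega⟩ : Fin n) ≠ y := by
      rcases hy with rfl | rfl <;> simp only [ha, hb, ne_eq, Fin.mk.injEq] <;> omega
    simp only [pairSign, Finset.mem_insert, h1, h2, false_or]
  have hi_sign : ∀ y, pairSign h (insert y T) ⟨i, hi⟩ =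
      (if y = a then 1 else 0) - if y = b then 1 else 0 := by
    intro y
    change (if a ∈ insert y T then 1 else 0) - (if b ∈ insert y T then 1 else 0) = _
    simp only [Finset.mem_insert, haT, hbT, or_false, eq_comm (a := a), eq_comm (a := b)]
  have hP : ∀ y ∈ Tᶜ, pairProduct h (insert y T) =
      ((if y = a then 1 else 0) - if y = b then 1 else 0) * P := by
    intro y _
    rw [pairProduct, ← Finset.mul_prod_erase _ _ (Finset.mem_univ (⟨i, hi⟩ : Fin m)), hi_sign]
    by_cases hya : y = a
    · rw [hrest y (Or.inl hya)]
    · by_cases hyb : y = b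
      · rw [hrest y (Or.inr hyb)]
      · simp [hya, hyb]
  rw [Finset.sum_congr rfl hP, ← Finset.sum_mul, Finset.sum_sub_distrib]
  simp [haT, hbT]

/-- After removing `x`, the sum over all reinsertions vanishes; putting `x` back accounts for one
term `pairProduct h S`, so the others sum to its negative. -/
theorem sum_pairProduct_exchange (h : 2 * m ≤ n) {S : Finset (Fin n)} (hS : S.card = m) :
    ∑ x ∈ S, ∑ y ∈ Sᶜ, pairProduct h (insert y (S.erase x)) = -m * pairProduct h S := by
  have key : ∀ x ∈ S, ∑ y ∈ Sᶜ, pairProduct h (insert y (S.erase x)) = -pairProduct h S := by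
    intro x hx
    have h0 := sum_pairProduct_insert h (T := S.erase x) (by
      rw [← hS]
      exact Finset.card_erase_lt_of_mem hx)
    rw [Finset.compl_erase, Finset.sum_insert (by simpa using hx), Finset.insert_erase hx] at h0
    linear_combination h0
  rw [Finset.sum_congr rfl key, Finset.sum_const, hS, nsmul_eq_mul]
  ring

theorem exists_pairProduct_ne_zero (h : 2 * m ≤ n) :
    ∃ S : Finset (Fin n), S.card = m ∧ pairProduct h S ≠ 0 := by
  have hinj : Function.Injective fun i : Fin m => (⟨i, by omega⟩ : Fin n) := fun i j hij =>
    Fin.ext (by simpa using hij)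
  refine ⟨Finset.univ.image fun i : Fin m => (⟨i, by omega⟩ : Fin n), ?_, ?_⟩
  · rw [Finset.card_image_of_injective _ hinj, Finset.card_univ, Fintype.card_fin]
  · refine Finset.prod_ne_zero_iff.2 fun i _ => ?_
    rw [pairSign, if_pos (Finset.mem_image_of_mem _ (Finset.mem_univ i)), if_neg]
    · simp
    · simp only [Finset.mem_image, Finset.mem_univ, true_and, Fin.mk.injEq, not_exists]
      intro j
      omega

theorem johnsonGraph_exists_eigenvector {k : ℕ} (hkn : k ≤ n) :
    ∃ f : {s : Finset (Fin n) // s.card = k} → ℂ, (∃ S, f S ≠ 0) ∧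
      ∀ S, ∑ R ∈ (johnsonGraph n k).neighborFinset S, f R = -(min k (n - k) : ℕ) * f S := by
  rcases le_total k (n - k) with hle | hle
  · rw [min_eq_left hle]
    have h : 2 * k ≤ n := by omega
    obtain ⟨S, hS, hne⟩ := exists_pairProduct_ne_zero h
    refine ⟨fun S => pairProduct h S.1, ⟨⟨S, hS⟩, hne⟩, fun S => ?_⟩
    rw [johnsonGraph_sum_neighborFinset, sum_pairProduct_exchange h S.2]
  · rw [min_eq_right hle]
    have h : 2 * (n - k) ≤ n := by omega
    obtain ⟨S, hS, hne⟩ := exists_pairProduct_ne_zero h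
    -- Complementation identifies `J(n,k)` with `J(n,n-k)`, which reduces to the first case.
    refine ⟨fun S => pairProduct h S.1ᶜ, ⟨⟨Sᶜ, ?_⟩, ?_⟩, fun S => ?_⟩
    · rw [Finset.card_compl, hS, Fintype.card_fin]
      omega
    · simpa using hne
    · have hc : S.1ᶜ.card = n - k := by rw [Finset.card_compl, S.2, Fintype.card_fin]
      rw [johnsonGraph_sum_neighborFinset (fun R => pairProduct h Rᶜ),
        ← sum_pairProduct_exchange h hc, compl_compl, Finset.sum_comm]
      refine Finset.sum_congr rfl fun y hy => Finset.sum_congr rfl fun x hx => ?_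
      congr 1
      ext a
      simp only [Finset.mem_compl, Finset.mem_insert, Finset.mem_erase] at hy ⊢
      grind

theorem max_le_two_of_isGroverPeriodic {k : ℕ} (hk : 1 ≤ k) (hkn : k < n)
    (hper : (johnsonGraph n k).IsGroverPeriodic) : max k (n - k) ≤ 2 := by
  obtain ⟨t, ht, hU⟩ := isGroverPeriodic_iff_exists_pow.1 hper
  obtain ⟨f, ⟨S, hS⟩, hf⟩ := johnsonGraph_exists_eigenvector hkn.le
  have hd : k * (n - k) ≠ 0 := (Nat.mul_pos hk (Nat.sub_pos_of_lt hkn)).ne'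
  have hint := (johnsonGraph_isRegularOfDegree n k).isIntegral_of_groverMatrix_pow_eq_one hd ht hU
    hf hS
  set M := max k (n - k) with hM
  set m := min k (n - k) with hm
  have hmM : m * M = k * (n - k) := min_mul_max _ _
  have hM0 : (M : ℚ) ≠ 0 := Nat.cast_ne_zero.2 fun h0 => hd (by rw [← hmM, h0, mul_zero])
  have hm0 : (m : ℚ) ≠ 0 := Nat.cast_ne_zero.2 fun h0 => hd (by rw [← hmM, h0, zero_mul])
  have hq : 2 * -(m : ℂ) / (k * (n - k) : ℕ) = algebraMap ℚ ℂ (-2 / M) := by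
    rw [← hmM]
    have h1 : (M : ℂ) ≠ 0 := by exact_mod_cast hM0
    have h2 : (m : ℂ) ≠ 0 := by exact_mod_cast hm0
    push_cast [eq_ratCast]
    field_simp
  rw [hq, isIntegral_algebraMap_iff (algebraMap ℚ ℂ).injective] at hint
  obtain ⟨z, hz⟩ := IsIntegrallyClosed.isIntegral_iff.1 hint
  rw [eq_intCast, eq_div_iff hM0] at hz
  have hz' : z * M = -2 := by exact_mod_cast hz
  have hdvd : (M : ℤ) ∣ 2 := ⟨-z, by linarith⟩
  exact_mod_cast Int.le_of_dvd two_pos hdvd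

/-! ### The periodic cases -/

theorem johnsonGraph_two_one_isGroverPeriodic : (johnsonGraph 2 1).IsGroverPeriodic := by
  have hdart : ∀ e f : (johnsonGraph 2 1).Dart, f.snd = e.fst → f = e.symm := by
    have hnb : ∀ u v w, (johnsonGraph 2 1).Adj u v → (johnsonGraph 2 1).Adj u w → v = w := by
      decide +kernel
    intro e f hfe
    refine Dart.ext _ _ (Prod.ext ?_ hfe)
    exact hnb e.fst _ _ (hfe ▸ f.adj.symm) e.adj
  -- In degree 1 the reflection entry is `2/1 - 1 = 1`, so `U` is arc reversal.
  have hU : (johnsonGraph 2 1).groverMatrix =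
      Matrix.of fun e f => if f = e.symm then 1 else 0 := by
    ext e f
    have hiff : f.snd = e.fst ↔ f = e.symm := ⟨hdart e f, by rintro rfl; rfl⟩
    rw [groverMatrix_apply, (johnsonGraph_isRegularOfDegree 2 1).degree_eq]
    simp only [hiff, of_apply]
    split_ifs <;> norm_num
  refine isGroverPeriodic_iff_exists_pow.2 ⟨2, two_pos, ?_⟩
  ext e f
  rw [hU, pow_two, mul_apply, one_apply]
  have hsymm : ∀ j : (johnsonGraph 2 1).Dart, f = j.symm ↔ j = f.symm := fun j =>
    ⟨fun h => by rw [h, Dart.symm_symm], fun h => by rw [h, Dart.symm_symm]⟩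
  simp [hsymm, Dart.symm_involutive.injective.eq_iff, eq_comm]

theorem johnsonGraph_three_one_isGroverPeriodic : (johnsonGraph 3 1).IsGroverPeriodic :=
  isGroverPeriodic_iff_exists_pow.2 ⟨12, by norm_num,
    (johnsonGraph_isRegularOfDegree 3 1).groverMatrix_pow_twelve_of_card_inter (by norm_num)
      (b := 8) (by decide +kernel)⟩

theorem johnsonGraph_three_two_isGroverPeriodic : (johnsonGraph 3 2).IsGroverPeriodic :=
  isGroverPeriodic_iff_exists_pow.2 ⟨12, by norm_num,
    (johnsonGraph_isRegularOfDegree 3 2).groverMatrix_pow_twelve_of_card_inter (by norm_num)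
      (b := 8) (by decide +kernel)⟩

theorem johnsonGraph_four_two_isGroverPeriodic : (johnsonGraph 4 2).IsGroverPeriodic :=
  isGroverPeriodic_iff_exists_pow.2 ⟨12, by norm_num,
    (johnsonGraph_isRegularOfDegree 4 2).groverMatrix_pow_twelve_of_card_inter (by norm_num)
      (b := 16) (by decide +kernel)⟩

end Johnson

theorem theorem1p4 (n k : ℕ) (hk : 1 ≤ k) (hkn : k < n) :
    (johnsonGraph n k).IsGroverPeriodic ↔
      (n, k) ∈ ({(2, 1), (3, 1), (3, 2), (4, 2)} : Set (ℕ × ℕ)) := by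
  simp only [Set.mem_insert_iff, Set.mem_singleton_iff, Prod.mk.injEq]
  constructor
  · intro hper
    have := max_le_two_of_isGroverPeriodic hk hkn hper
    omega
  · rintro (⟨rfl, rfl⟩ | ⟨rfl, rfl⟩ | ⟨rfl, rfl⟩ | ⟨rfl, rfl⟩)
    · exact johnsonGraph_two_one_isGroverPeriodic
    · exact johnsonGraph_three_one_isGroverPeriodic
    · exact johnsonGraph_three_two_isGroverPeriodic
    · exact johnsonGraph_four_two_isGroverPeriodic
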